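/- Let $n$ be an odd positive integer and let $S$ be a finite set of integers such that every $i\in S$ is either odd with $0<i<n/3$, or satisfies $i\equiv n \pmod 4$ and $0<i<n$. Let $$f(x)=x^n+\sum_{i\in S}x^i+1\in\mathbb F_2[x],\qquad F(x)=x^n+\sum_{i\in S}x^i+1\in\mathbb Z[x].$$ Then $f$ is squarefree and has no repeated roots in an algebraic closure of $\mathbb F_2$. If $n\equiv\pm1\pmod 8$, then $f$ has an odd number of irreducible factors in $\mathbb F_2[x]$ and $\operatorname{disc}(F)\equiv1\pmod 8$. If $n\equiv\pm3\pmod 8$, then $f$ has an even number of irreducible factors in $\mathbb F_2[x]$ and $\operatorname{disc}(F)\equiv5\pmod 8$. -/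

import Mathlib

open Polynomial

/-! All exponents in `S` are odd, so over `𝔽₂` one has `f - X f' = 1`, which makes `f` separable.
The parity of the number of factors then follows from Stickelberger's theorem once the discriminant
of `F` is known modulo 8. Up to the sign `(-1) ^ (n(n-1)/2)`, the discriminant is the product of the
`F'(rᵢ)` over the roots. Eliminating `rᵢ ^ n` gives `rᵢ F'(rᵢ) = -n + 2 vᵢ` with `vᵢ = ∑ (j - n)/2 ·
rᵢ ^ j`, and modulo 8 the product of these depends only on `∑ vᵢ` and `∑ vᵢ ^ 2`. The gaps in the
exponents make enough power sums vanish, by Newton's identities, that the first is 0 and the second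
is divisible by 4. As `∏ rᵢ = -1`, the discriminant is `± n ^ n ≡ ± n` modulo 8. -/

theorem Polynomial.Monic.map_discr {R S : Type*} [CommRing R] [CommRing S] [Nontrivial S]
    (φ : R →+* S) {p : R[X]} (hp : p.Monic) (hd : 0 < p.natDegree) :
    φ p.discr = (p.map φ).discr := by
  have h1 := congrArg φ (resultant_deriv (natDegree_pos_iff_degree_pos.mp hd))
  have h2 := resultant_deriv (f := p.map φ)
    (natDegree_pos_iff_degree_pos.mp (by rwa [hp.natDegree_map]))
  rw [← resultant_map_map, ← derivative_map] at h1
  rw [hp.natDegree_map, h1, hp.leadingCoeff, (hp.map φ).leadingCoeff] at h2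
  simp only [map_mul, map_pow, map_neg, map_one, mul_one] at h2
  exact ((isUnit_one.neg.pow _).mul_right_inj).mp h2

/-! ### Discriminants through roots, and a product modulo 8 -/

section Roots

variable {R : Type*} [CommRing R] {n : ℕ} (r : Fin n → R)

theorem eval_derivative_prod_X_sub_C (i : Fin n) :
    (derivative (∏ j, (X - C (r j)))).eval (r i) = ∏ j ∈ {i}ᶜ, (r i - r j) := by
  classical
  rw [derivative_prod_finset, eval_finsetSum, Finset.sum_eq_single i]
  · simp [eval_prod, Finset.compl_eq_univ_sdiff, Finset.sdiff_singleton_eq_erase]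
  · intro k _ hk
    rw [eval_mul, eval_prod, Finset.prod_eq_zero (i := i) (by simp [hk.symm]) (by simp), zero_mul]
  · simp

theorem discr_prod_X_sub_C_eq_prod_eval_derivative [IsDomain R] (hn : 0 < n) :
    (∏ i, (X - C (r i))).discr = (-1) ^ (n * (n - 1) / 2) *
      ∏ i, (derivative (∏ j, (X - C (r j)))).eval (r i) := by
  have hm : (∏ i, (X - C (r i))).Monic := monic_prod_X_sub_C r _
  have hd : (∏ i, (X - C (r i))).natDegree = n := by simp
  have h1 := resultant_deriv (f := ∏ i, (X - C (r i)))
    (natDegree_pos_iff_degree_pos.mp (by rwa [hd]))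
  rw [resultant_eq_prod_eval _ _ _ (natDegree_derivative_le _)
    (Splits.prod fun i _ => Splits.X_sub_C (r i)), hm.leadingCoeff, hd, one_pow, one_mul,
    mul_one] at h1
  have h2 : (∏ i, (X - C (r i))).roots = Finset.univ.val.map r := by
    rw [← roots_multiset_prod_X_sub_C (Finset.univ.val.map r), Multiset.map_map]
    rfl
  rw [h2, Multiset.map_map] at h1
  change ∏ i, _ = _ at h1
  simp only [Function.comp_apply] at h1
  rw [h1, ← mul_assoc, ← mul_pow]
  simp

theorem discr_prod_X_sub_C [IsDomain R] (hn : 0 < n) :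
    (∏ i, (X - C (r i))).discr = (Matrix.vandermonde r).det ^ 2 := by
  rw [discr_prod_X_sub_C_eq_prod_eval_derivative r hn]
  simp_rw [eval_derivative_prod_X_sub_C]
  rw [← Finset.prod_prod_Ioi_mul_eq_prod_prod_off_diag (fun i j => r j - r i),
    Matrix.det_vandermonde, ← Finset.prod_pow]
  have h (i : Fin n) : ∏ j ∈ Finset.Ioi i, (r i - r j) * (r j - r i) =
      (-1) ^ (n - 1 - i : ℕ) * (∏ j ∈ Finset.Ioi i, (r j - r i)) ^ 2 := by
    rw [← Fin.card_Ioi, ← Finset.prod_const, ← Finset.prod_pow, ← Finset.prod_mul_distrib]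
    exact Finset.prod_congr rfl fun j _ => by ring
  have hs : ∑ i : Fin n, (n - 1 - i : ℕ) = n * (n - 1) / 2 := by
    rw [Finset.sum_range (fun i => n - 1 - i) |>.symm, Finset.sum_range_reflect (fun i => i),
      Finset.sum_range_id]
  simp_rw [h]
  rw [Finset.prod_mul_distrib, Finset.prod_pow_eq_pow_sum, hs, ← mul_assoc, ← mul_pow]
  simp

/-- Modulo `8`, the product of the `a + 2 vᵢ` depends only on the first two elementary symmetric
functions of `v`; the second one is expressed through `(∑ vᵢ) ^ 2 = ∑ vᵢ ^ 2 + 2 E`. -/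
theorem exists_prod_add_two_mul {ι : Type*} (s : Finset ι) (v : ι → R) {a m : R}
    (ha : a ^ 2 = 1 + 8 * m) :
    ∃ E B : R, (∑ i ∈ s, v i) ^ 2 = ∑ i ∈ s, v i ^ 2 + 2 * E ∧
      ∏ i ∈ s, (a + 2 * v i) = a ^ s.card * (1 + 2 * a * ∑ i ∈ s, v i + 4 * E) + 8 * B := by
  classical
  induction s using Finset.induction_on with
  | empty => exact ⟨0, 0, by simp, by simp⟩
  | insert i s hi ih =>
    obtain ⟨E, B, h1, h2⟩ := ih
    -- `E` is the second elementary symmetric function; the term in `m` comes from replacing `1` by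
    -- `a ^ 2 - 8 * m`.
    refine ⟨E + v i * ∑ j ∈ s, v j, (a + 2 * v i) * B + a ^ s.card * (v i * E - 2 * v i * m),
      ?_, ?_⟩
    · rw [Finset.sum_insert hi, Finset.sum_insert hi]; linear_combination h1
    · rw [Finset.prod_insert hi, Finset.sum_insert hi, Finset.card_insert_of_notMem hi, h2]
      linear_combination (-2 * v i * a ^ s.card) * ha

end Roots

/-! ### Cycles of Frobenius and irreducible factors -/

theorem Finset.card_image_eq_card_image {α β γ : Type*} [DecidableEq β] [DecidableEq γ]
    (s : Finset α) (f : α → β) (g : α → γ) (h : ∀ i ∈ s, ∀ j ∈ s, (f i = f j ↔ g i = g j)) :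
    (s.image f).card = (s.image g).card := by
  have hf : (s.image f) = (s.image fun i => (f i, g i)).image Prod.fst := by
    rw [Finset.image_image]; rfl
  have hg : (s.image g) = (s.image fun i => (f i, g i)).image Prod.snd := by
    rw [Finset.image_image]; rfl
  rw [hf, hg]
  refine (Finset.card_image_of_injOn ?_).trans (Finset.card_image_of_injOn ?_).symm
  all_goals
    intro a ha b hb hab
    simp only [Finset.coe_image, Set.mem_image, Finset.mem_coe] at ha hb
    obtain ⟨i, hi, rfl⟩ := ha
    obtain ⟨j, hj, rfl⟩ := hb
    have := h i hi j hj
    simp_all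

/-- If the fibres of the surjection `c` are the cycles of `π`, including the fixed points, then
`c` determines the sign of `π`. -/
theorem Equiv.Perm.sign_eq_neg_one_pow_card_add_card {α β : Type*} [Fintype α] [DecidableEq α]
    [DecidableEq β] (π : Equiv.Perm α) (c : α → β)
    (hc : ∀ i j, c i = c j ↔ π.SameCycle i j) :
    Equiv.Perm.sign π = (-1) ^ (Fintype.card α + (Finset.univ.image c).card) := by
  classical
  have h1 : (π.support.image c).card = π.cycleFactorsFinset.card := by
    have : π.cycleFactorsFinset = π.support.image π.cycleOf := by
      ext g
      simp only [Finset.mem_image]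
      constructor
      · intro hg
        obtain ⟨a, ha⟩ := (Equiv.Perm.mem_cycleFactorsFinset_iff.mp hg).1.nonempty_support
        exact ⟨a, Equiv.Perm.mem_cycleFactorsFinset_support_le hg ha,
          (Equiv.Perm.cycle_is_cycleOf ha hg).symm⟩
      · rintro ⟨a, ha, rfl⟩
        exact Equiv.Perm.cycleOf_mem_cycleFactorsFinset_iff.mpr ha
    rw [this]
    exact Finset.card_image_eq_card_image _ _ _ fun i hi j hj => (hc i j).trans
      (Equiv.Perm.sameCycle_iff_cycleOf_eq_of_mem_support hi hj)
  have h2 : ((π.support)ᶜ.image c).card = (π.support)ᶜ.card := by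
    refine Finset.card_image_of_injOn fun i hi j hj h => ?_
    have hi' : π i = i := by simpa using hi
    exact (((hc i j).mp h).eq_of_left hi')
  have h3 : (Finset.univ.image c).card = π.cycleFactorsFinset.card + (π.support)ᶜ.card := by
    rw [← h1, ← h2, ← Finset.card_union_of_disjoint, ← Finset.image_union, Finset.union_compl]
    rw [Finset.disjoint_left]
    simp only [Finset.mem_image, not_exists, not_and]
    rintro _ ⟨i, hi, rfl⟩ j hj h
    have hj' : π j = j := by simpa using hj
    obtain rfl := ((hc j i).mp h).eq_of_left hj'
    exact Finset.mem_compl.mp hj hi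
  rw [Equiv.Perm.sign_of_cycleType, Equiv.Perm.sum_cycleType, h3]
  have h4 : Multiset.card π.cycleType = π.cycleFactorsFinset.card := by
    simp [Equiv.Perm.cycleType_def]
  -- Fixed points are counted once as points and once as cycles, so they do not affect the sign.
  have h5 := Finset.card_add_card_compl π.support
  rw [h4, ← h5, show π.support.card + π.supportᶜ.card + (π.cycleFactorsFinset.card + π.supportᶜ.card)
    = (π.support.card + π.cycleFactorsFinset.card) + 2 * π.supportᶜ.card by ring, pow_add _ _ (2 * _),
    pow_mul]
  simp

/-- The sign of the Frobenius permutation of the roots of a separable polynomial over `𝔽_p`. -/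
theorem sign_frobenius_eq {p : ℕ} [Fact p.Prime] {k : Type*} [Field k] [Finite k]
    [Algebra (ZMod p) k] {n : ℕ} {f : (ZMod p)[X]} (hf : f.Separable) (x : Fin n → k)
    (hx : f.map (algebraMap (ZMod p) k) = ∏ i, (X - C (x i))) (π : Equiv.Perm (Fin n))
    (hπ : ∀ i, x (π i) = x i ^ p) :
    Equiv.Perm.sign π =
      (-1) ^ (n + (UniqueFactorizationMonoid.normalizedFactors f).card) := by
  classical
  have hf0 : f ≠ 0 := hf.ne_zero
  have hinj : Function.Injective x := by
    have := hf.map (f := algebraMap (ZMod p) k)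
    rw [hx] at this
    exact (separable_prod_X_sub_C_iff).mp this
  have hroot (y : k) : aeval y f = 0 ↔ ∃ i, x i = y := by
    rw [← eval_map_algebraMap, hx, eval_prod, Finset.prod_eq_zero_iff]
    simp [sub_eq_zero, eq_comm]
  have hpow (m : ℕ) (i : Fin n) : x ((π ^ m) i) = x i ^ p ^ m := by
    induction m with
    | zero => simp
    | succ m ih => rw [pow_succ', Equiv.Perm.mul_apply, hπ, ih, ← pow_mul, pow_succ]
  -- The Galois group of `k` consists of powers of Frobenius, so conjugate roots are exactly those
  -- in one cycle.
  have hc (i j : Fin n) : minpoly (ZMod p) (x i) = minpoly (ZMod p) (x j) ↔ π.SameCycle i j := by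
    constructor
    · intro h
      obtain ⟨σ, hσ⟩ := isConjRoot_iff_exists_algEquiv.mp (show IsConjRoot (ZMod p) (x i) (x j) from h)
      obtain ⟨m, hm⟩ :=
        (FiniteField.bijective_frobeniusAlgEquivOfAlgebraic_pow (ZMod p) k).2 σ
      refine Equiv.Perm.SameCycle.symm ⟨(m : ℕ), hinj ?_⟩
      rw [zpow_natCast, hpow, ← hσ, ← hm]
      simp only [AlgEquiv.coe_pow, FiniteField.coe_frobeniusAlgEquivOfAlgebraic_iterate, ZMod.card]
    · intro h
      obtain ⟨m, hm⟩ := h.exists_nat_pow_eq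
      refine (isConjRoot_of_algEquiv (x i)
        (FiniteField.frobeniusAlgEquivOfAlgebraic (ZMod p) k ^ m)).trans ?_
      rw [AlgEquiv.coe_pow, FiniteField.coe_frobeniusAlgEquivOfAlgebraic_iterate, ZMod.card]
      beta_reduce
      rw [← hpow, hm]
  have himg : Finset.univ.image (fun i => minpoly (ZMod p) (x i)) =
      (UniqueFactorizationMonoid.normalizedFactors f).toFinset := by
    ext g
    simp only [Finset.mem_image, Finset.mem_univ, true_and, Multiset.mem_toFinset]
    rw [Polynomial.mem_normalizedFactors_iff hf0]
    constructor
    · rintro ⟨i, rfl⟩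
      exact ⟨minpoly.irreducible (.of_finite _ _), minpoly.monic (.of_finite _ _),
        minpoly.dvd _ _ ((hroot _).mpr ⟨i, rfl⟩)⟩
    · rintro ⟨h1, h2, h3⟩
      have hs : (f.map (algebraMap (ZMod p) k)).Splits :=
        hx ▸ Splits.prod fun i _ => Splits.X_sub_C (x i)
      obtain ⟨y, hy⟩ := (hs.of_dvd (by simpa using hf0) (map_dvd _ h3)).exists_eval_eq_zero
        (by simpa using h1.degree_pos.ne')
      rw [eval_map_algebraMap] at hy
      obtain ⟨i, rfl⟩ := (hroot y).mp (aeval_eq_zero_of_dvd_aeval_eq_zero h3 hy)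
      exact ⟨i, (minpoly.eq_of_irreducible_of_monic h1 hy h2).symm⟩
  have hnd : (UniqueFactorizationMonoid.normalizedFactors f).Nodup :=
    (UniqueFactorizationMonoid.squarefree_iff_nodup_normalizedFactors hf0).mp hf.squarefree
  have := π.sign_eq_neg_one_pow_card_add_card (fun i => minpoly (ZMod p) (x i)) hc
  rwa [himg, Multiset.toFinset_card_of_nodup hnd, Fintype.card_fin] at this

/-! ### Roots in rings of integers -/

theorem Multiset.exists_univ_val_map_eq {α : Type*} (m : Multiset α) {n : ℕ} (h : m.card = n) :
    ∃ s : Fin n → α, Finset.univ.val.map s = m := by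
  subst h
  induction m using Quotient.inductionOn with
  | h l => exact ⟨l.get, (Fin.univ_val_map _).trans (congrArg _ (List.ofFn_get l))⟩

/-- The quotient `b / a` is rational and integral, and `ℤ` is integrally closed. This brings
congruences between integers back from `𝓞 K`. -/
theorem NumberField.RingOfIntegers.dvd_of_intCast_dvd_intCast {K : Type*} [Field K]
    [NumberField K] {a b : ℤ} (h : ((a : ℤ) : NumberField.RingOfIntegers K) ∣ (b : ℤ)) : a ∣ b := by
  obtain ⟨c, hc⟩ := h
  obtain rfl | ha := eq_or_ne a 0
  · simpa using hc
  have hc' : (b : K) = a * (c : K) := by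
    have := congrArg (algebraMap (NumberField.RingOfIntegers K) K) hc
    simpa using this
  have haK : (a : K) ≠ 0 := by exact_mod_cast ha
  have hq : algebraMap ℚ K ((b : ℚ) / a) = c := by
    rw [map_div₀]; simp only [map_intCast]; rw [hc']; field_simp
  have hint : IsIntegral ℤ ((b : ℚ) / a) := by
    rw [← isIntegral_algebraMap_iff (algebraMap ℚ K).injective, hq]
    exact c.isIntegral_coe
  obtain ⟨d, hd⟩ := IsIntegrallyClosed.isIntegral_iff.mp hint
  refine ⟨d, ?_⟩
  have haQ : (a : ℚ) ≠ 0 := by exact_mod_cast ha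
  rw [eq_div_iff haQ] at hd
  simp only [algebraMap_int_eq, eq_intCast] at hd
  have : (b : ℚ) = a * d := by linarith
  exact_mod_cast this

theorem NumberField.RingOfIntegers.exists_map_eq_prod_X_sub_C {K : Type*} [Field K]
    [NumberField K] {F : ℤ[X]} (hF : F.Monic) {n : ℕ} (hn : F.natDegree = n)
    (hs : (F.map (algebraMap ℤ K)).Splits) :
    ∃ r : Fin n → NumberField.RingOfIntegers K,
      F.map (algebraMap ℤ (NumberField.RingOfIntegers K)) = ∏ i, (X - C (r i)) := by
  have hm := hF.map (algebraMap ℤ K)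
  have hcard : (F.map (algebraMap ℤ K)).roots.card = n := by
    rw [← hn, ← hs.natDegree_eq_card_roots, hF.natDegree_map]
  obtain ⟨s, hsr⟩ := Multiset.exists_univ_val_map_eq _ hcard
  have hs' : F.map (algebraMap ℤ K) = ∏ i, (X - C (s i)) := by
    conv_lhs => rw [hs.eq_prod_roots_of_monic hm, ← hsr, Multiset.map_map]
    rfl
  have hint (i) : IsIntegral ℤ (s i) := by
    refine ⟨F, hF, ?_⟩
    rw [← eval_map, hs', eval_prod, Finset.prod_eq_zero (Finset.mem_univ i) (by simp)]
  choose t ht using fun i => IsIntegralClosure.isIntegral_iff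
    (A := NumberField.RingOfIntegers K).mp (hint i)
  refine ⟨t, ?_⟩
  apply map_injective (algebraMap (NumberField.RingOfIntegers K) K)
    (FaithfulSMul.algebraMap_injective _ _)
  rw [map_map, ← IsScalarTower.algebraMap_eq, hs', Polynomial.map_prod]
  exact Finset.prod_congr rfl fun i _ => by
    rw [Polynomial.map_sub, map_X, map_C, ht]

theorem exists_numberField_splits (F : ℤ[X]) :
    ∃ (K : Type) (_ : Field K) (_ : NumberField K), IsGalois ℚ K ∧
      (F.map (algebraMap ℤ K)).Splits := by
  have : Normal ℚ (F.map (algebraMap ℤ ℚ)).SplittingField :=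
    SplittingField.instNormal (F.map (algebraMap ℤ ℚ))
  refine ⟨(F.map (algebraMap ℤ ℚ)).SplittingField, inferInstance, { }, IsGalois.mk, ?_⟩
  have := SplittingField.splits (F.map (algebraMap ℤ ℚ))
  rwa [map_map, ← IsScalarTower.algebraMap_eq] at this

/-! ### Stickelberger's theorem at 2 -/

open NumberField in
-- Let `φ` be a Frobenius at a prime `Q` above 2, and `δ` the Vandermonde determinant of the roots,
-- so `δ ^ 2 = 4d + 1` and `φ δ = ± δ` with the sign of the root permutation. Then `θ = (1 + δ)/2`
-- is integral with `θ ^ 2 - θ = d`, so `φ θ - θ ≡ d` modulo `Q`. The left side is 0 for an even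
-- permutation and `1 - 2θ ≡ 1` for an odd one.
theorem even_natDegree_add_card_normalizedFactors_iff_of_splits (K : Type*) [Field K]
    [NumberField K] [IsGalois ℚ K] {F : ℤ[X]} (hF : F.Monic) (hd : 0 < F.natDegree)
    (hspl : (F.map (algebraMap ℤ K)).Splits) (hsep : (F.map (algebraMap ℤ (ZMod 2))).Separable)
    {d : ℤ} (hD : F.discr = 4 * d + 1) :
    Even (F.natDegree + (UniqueFactorizationMonoid.normalizedFactors
      (F.map (algebraMap ℤ (ZMod 2)))).card) ↔ Even d := by
  generalize hn : F.natDegree = n at *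
  obtain ⟨r, hr⟩ := RingOfIntegers.exists_map_eq_prod_X_sub_C hF hn hspl
  set G := 𝓞 K ≃ₐ[ℤ] 𝓞 K
  have : Finite G := Finite.of_equiv _ (galRestrict ℤ ℚ K (𝓞 K)).toEquiv
  have : Algebra.IsInvariant ℤ (𝓞 K) G := Algebra.isInvariant_of_isGalois' ℤ ℚ K (𝓞 K)
  obtain ⟨Q, hQ, h2Q⟩ : ∃ Q : Ideal (𝓞 K), Q.IsMaximal ∧ (2 : 𝓞 K) ∈ Q := by
    obtain ⟨Q, hQ, hle⟩ := Ideal.exists_le_maximal (Ideal.span {(2 : 𝓞 K)}) (by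
      rw [Ne, Ideal.span_singleton_eq_top]
      intro h
      have := RingOfIntegers.dvd_of_intCast_dvd_intCast (K := K) (a := 2) (b := 1)
        (by simpa using h.dvd)
      norm_num at this)
    exact ⟨Q, hQ, hle (Ideal.subset_span rfl)⟩
  let k := 𝓞 K ⧸ Q
  let : Field k := Ideal.Quotient.field Q
  have : CharP k 2 := CharTwo.of_one_ne_zero_of_two_eq_zero one_ne_zero
    (Ideal.Quotient.eq_zero_iff_mem.mpr h2Q)
  let : Algebra (ZMod 2) k := ZMod.algebra k 2
  have hcast (m : ℤ) : (Ideal.Quotient.mk Q (m : 𝓞 K)) = 0 ↔ Even m := by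
    rw [map_intCast, even_iff_two_dvd]
    exact_mod_cast CharP.intCast_eq_zero_iff k 2 m
  obtain ⟨φ, hφ⟩ := IsArithFrobAt.exists_of_isInvariant ℤ G Q
  -- The residue field below `Q` has two elements, so `φ` acts as squaring modulo `Q`.
  have hunder : Q.under ℤ = Ideal.span {2} := by
    ext m
    rw [Ideal.mem_span_singleton, ← even_iff_two_dvd, ← hcast, Ideal.Quotient.eq_zero_iff_mem,
      Ideal.under, Ideal.mem_comap]
    simp
  have hφ' (x : 𝓞 K) : Ideal.Quotient.mk Q (φ x) = (Ideal.Quotient.mk Q x) ^ 2 := by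
    have h := hφ x
    rw [hunder, Nat.card_congr (Int.quotientSpanEquivZMod 2).toEquiv] at h
    rw [← map_pow, Ideal.Quotient.eq]
    exact (by simpa using h : φ • x - x ^ 2 ∈ Q)
  have hx : (F.map (algebraMap ℤ (ZMod 2))).map (algebraMap (ZMod 2) k) =
      ∏ i, (X - C (Ideal.Quotient.mk Q (r i))) := by
    have := congrArg (Polynomial.map (Ideal.Quotient.mk Q)) hr
    rw [map_map, Polynomial.map_prod] at this
    rw [map_map, RingHom.ext_int ((algebraMap (ZMod 2) k).comp (algebraMap ℤ (ZMod 2)))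
      ((Ideal.Quotient.mk Q).comp (algebraMap ℤ (𝓞 K))), this]
    simp
  have hinj : Function.Injective fun i => Ideal.Quotient.mk Q (r i) := by
    have := hsep.map (f := algebraMap (ZMod 2) k)
    rw [hx] at this
    exact separable_prod_X_sub_C_iff.mp this
  have hinj' : Function.Injective r := hinj.of_comp (f := Ideal.Quotient.mk Q)
  have hperm (i : Fin n) : ∃ j, r j = φ (r i) := by
    have h1 : aeval (φ (r i)) F = 0 := by
      have : aeval (r i) F = 0 := by
        rw [← eval_map_algebraMap, hr, eval_prod, Finset.prod_eq_zero (Finset.mem_univ i) (by simp)]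
      rw [aeval_algHom_apply, this, map_zero]
    rw [← eval_map_algebraMap, hr, eval_prod, Finset.prod_eq_zero_iff] at h1
    obtain ⟨j, -, hj⟩ := h1
    exact ⟨j, (sub_eq_zero.mp (by simpa using hj)).symm⟩
  choose p hp using hperm
  have hpinj : Function.Injective p := fun i j h => hinj' (φ.injective (by rw [← hp, ← hp, h]))
  let π : Equiv.Perm (Fin n) := Equiv.ofBijective p (Finite.injective_iff_bijective.mp hpinj)
  have hπ (i) : r (π i) = φ (r i) := hp i
  have hsign := sign_frobenius_eq hsep (fun i => Ideal.Quotient.mk Q (r i)) hx π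
    (fun i => by rw [hπ, hφ'])
  set δ := (Matrix.vandermonde r).det with hδ
  have hδ2 : δ ^ 2 = 4 * d + 1 := by
    rw [hδ, ← discr_prod_X_sub_C r hd, ← hr, ← hF.map_discr _ (hn ▸ hd), hD]
    simp
  have hφδ : φ δ = (Equiv.Perm.sign π : ℤ) * δ := by
    rw [hδ, ← Matrix.det_permute, AlgEquiv.map_det]
    congr 1
    ext i j
    simp [Matrix.vandermonde_apply, hπ]
  obtain ⟨θ, hθ⟩ : ∃ θ : 𝓞 K, 2 * θ = 1 + δ := by
    have hδK : (algebraMap (𝓞 K) K δ) ^ 2 = 4 * d + 1 := by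
      rw [← map_pow, hδ2]
      simp only [map_add, map_mul, map_ofNat, map_one, map_intCast]
    have hint : IsIntegral ℤ ((1 + algebraMap (𝓞 K) K δ) / 2) := by
      refine ⟨X ^ 2 - X - C d, by monicity!, ?_⟩
      rw [eval₂_sub, eval₂_sub, eval₂_pow, eval₂_X, eval₂_C, eq_intCast]
      linear_combination hδK / 4
    obtain ⟨θ, hθ⟩ := IsIntegralClosure.isIntegral_iff (A := 𝓞 K).mp hint
    refine ⟨θ, FaithfulSMul.algebraMap_injective (𝓞 K) K ?_⟩
    simp only [map_mul, map_add, map_one, map_ofNat, hθ]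
    field_simp
  have hθ2 : θ ^ 2 - θ = d := by
    have h4 : (4 : 𝓞 K) ≠ 0 := by norm_num
    refine mul_left_cancel₀ h4 ?_
    linear_combination (2 * θ + δ - 1) * hθ + hδ2
  have hφθ : 2 * φ θ = 1 + (Equiv.Perm.sign π : ℤ) * δ := by
    rw [← hφδ, ← map_one φ, ← map_add, ← hθ, map_mul, map_ofNat]
  have h2 : (2 : 𝓞 K) ≠ 0 := by norm_num
  have hmk : Ideal.Quotient.mk Q (φ θ - θ) = Ideal.Quotient.mk Q (d : 𝓞 K) := by
    rw [← hθ2, map_sub, map_sub, hφ', map_pow]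
  rcases Int.units_eq_one_or (Equiv.Perm.sign π) with h1 | h1
  · have he : φ θ - θ = 0 := by
      rw [h1] at hφθ
      refine mul_left_cancel₀ h2 ?_
      push_cast at hφθ
      linear_combination hφθ - hθ
    rw [he, map_zero, eq_comm, hcast] at hmk
    rw [h1, eq_comm, neg_one_pow_eq_one_iff_even (by decide)] at hsign
    exact iff_of_true hsign hmk
  · have he : φ θ - θ = 1 - 2 * θ := by
      rw [h1] at hφθ
      refine mul_left_cancel₀ h2 ?_
      push_cast at hφθ
      linear_combination hφθ + hθ
    have hd' : ¬ Even d := by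
      intro hd'
      rw [(hcast d).mpr hd', he, map_sub, map_mul, map_one,
        Ideal.Quotient.eq_zero_iff_mem.mpr h2Q] at hmk
      simp at hmk
    refine iff_of_false (fun he' => ?_) hd'
    rw [h1, he'.neg_one_pow] at hsign
    exact absurd hsign (by decide)

/-- **Stickelberger's parity theorem** at the prime `2`. -/
theorem even_natDegree_add_card_normalizedFactors_iff {F : ℤ[X]} (hF : F.Monic)
    (hd : 0 < F.natDegree) (hsep : (F.map (algebraMap ℤ (ZMod 2))).Separable) {d : ℤ}
    (hD : F.discr = 4 * d + 1) :
    Even (F.natDegree + (UniqueFactorizationMonoid.normalizedFactors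
      (F.map (algebraMap ℤ (ZMod 2)))).card) ↔ Even d := by
  obtain ⟨K, _, _, _, hspl⟩ := exists_numberField_splits F
  exact even_natDegree_add_card_normalizedFactors_iff_of_splits K hF hd hspl hsep hD

/-! ### Newton's identities and vanishing power sums -/

section PowerSums

variable {R : Type*} [CommRing R] {n : ℕ} (r : Fin n → R)

/-- **Newton's identities** in terms of the coefficients of a monic polynomial. -/
theorem sum_pow_eq_neg_coeff_sub_sum {k : ℕ} (hk : 0 < k) (hkn : k ≤ n) :
    ∑ i, r i ^ k = -(k * (∏ i, (X - C (r i))).coeff (n - k)) -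
      ∑ a ∈ Finset.HasAntidiagonal.antidiagonal k with a.1 ∈ Set.Ioo 0 k,
        (∏ i, (X - C (r i))).coeff (n - a.1) * ∑ i, r i ^ a.2 := by
  have hcoeff (j : ℕ) (hj : j ≤ n) : (∏ i, (X - C (r i))).coeff (n - j) =
      (-1) ^ j * MvPolynomial.aeval r (MvPolynomial.esymm (Fin n) R j) := by
    have h := Multiset.prod_X_sub_C_coeff (Finset.univ.val.map r) (k := n - j) (by simp)
    rw [Multiset.map_map] at h
    rw [MvPolynomial.aeval_esymm_eq_multiset_esymm]
    simp only [Multiset.card_map, Finset.card_val, Finset.card_univ, Fintype.card_fin,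
      Nat.sub_sub_self hj] at h
    exact h
  have h := congrArg (MvPolynomial.aeval r) (MvPolynomial.psum_eq_mul_esymm_sub_sum (Fin n) R k hk)
  simp only [MvPolynomial.psum, map_sum, map_pow, MvPolynomial.aeval_X, map_sub, map_mul, map_neg,
    map_one, map_natCast] at h
  rw [h, hcoeff k hkn]
  congr 1
  · ring
  · refine Finset.sum_congr rfl fun a ha => ?_
    simp only [Finset.mem_filter, Finset.HasAntidiagonal.mem_antidiagonal, Set.mem_Ioo] at ha
    rw [hcoeff a.1 (by omega)]

/-- A criterion for the vanishing of power sums: `A` is a set of exponents which is stable under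
subtraction of the indices of the nonzero coefficients. -/
theorem sum_pow_eq_zero_of_coeff (A : ℕ → Prop) (hA : ∀ k, A k → 0 < k ∧ k ≤ n)
    (h0 : ∀ k, A k → (∏ i, (X - C (r i))).coeff (n - k) = 0)
    (h1 : ∀ k j, A k → 0 < j → j < k → (∏ i, (X - C (r i))).coeff (n - j) = 0 ∨ A (k - j))
    {k : ℕ} (hk : A k) : ∑ i, r i ^ k = 0 := by
  induction k using Nat.strong_induction_on with
  | _ k ih =>
    rw [sum_pow_eq_neg_coeff_sub_sum r (hA k hk).1 (hA k hk).2, h0 k hk, Finset.sum_eq_zero]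
    · simp
    · intro a ha
      simp only [Finset.mem_filter, Finset.HasAntidiagonal.mem_antidiagonal, Set.mem_Ioo] at ha
      obtain h | h := h1 k a.1 hk ha.2.1 ha.2.2
      · rw [h, zero_mul]
      · rw [show k - a.1 = a.2 by omega] at h
        rw [ih a.2 (by omega) h, mul_zero]

end PowerSums

/-! ### The sparse polynomial over a general ring -/

section Sparse

variable (R : Type*) [CommRing R] (n : ℕ) (S : Finset ℕ)

theorem coeff_X_pow_add_sum_add_one {m : ℕ} (h0 : 0 < m) (hm : m < n) (hS : m ∉ S) :
    (X ^ n + ∑ i ∈ S, X ^ i + 1 : R[X]).coeff m = 0 := by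
  simp [coeff_X_pow, coeff_one, hm.ne, h0.ne', hS, Finset.sum_ite_eq]

variable {n S}

theorem monic_X_pow_add_sum_add_one (hn : 0 < n) (hS : ∀ i ∈ S, i < n) :
    (X ^ n + ∑ i ∈ S, X ^ i + 1 : R[X]).Monic := by
  rw [add_assoc]
  refine monic_X_pow_add ((degree_add_le _ _).trans_lt (max_lt ?_ ?_))
  · exact (degree_sum_le _ _).trans_lt
      ((Finset.sup_lt_iff (a := (n : WithBot ℕ)) (WithBot.bot_lt_coe n)).mpr fun i hi =>
        (degree_X_pow_le i).trans_lt (by exact_mod_cast hS i hi))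
  · exact degree_one_le.trans_lt (by exact_mod_cast hn)

theorem natDegree_X_pow_add_sum_add_one [Nontrivial R] (hn : 0 < n) (hS : ∀ i ∈ S, i < n) :
    (X ^ n + ∑ i ∈ S, X ^ i + 1 : R[X]).natDegree = n := by
  rw [add_assoc]
  refine natDegree_eq_of_degree_eq_some ?_
  rw [degree_add_eq_left_of_degree_lt] <;> rw [degree_X_pow]
  refine (degree_add_le _ _).trans_lt (max_lt ?_ ?_)
  · exact (degree_sum_le _ _).trans_lt
      ((Finset.sup_lt_iff (a := (n : WithBot ℕ)) (WithBot.bot_lt_coe n)).mpr fun i hi =>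
        (degree_X_pow_le i).trans_lt (by exact_mod_cast hS i hi))
  · exact degree_one_le.trans_lt (by exact_mod_cast hn)

theorem X_mul_derivative_X_pow_add_sum_add_one (hn : 0 < n) (hS : ∀ i ∈ S, 0 < i) :
    X * derivative (X ^ n + ∑ i ∈ S, X ^ i + 1 : R[X]) =
      (n : R[X]) * X ^ n + ∑ i ∈ S, (i : R[X]) * X ^ i := by
  have h (m : ℕ) (hm : 0 < m) : X * derivative (X ^ m : R[X]) = (m : R[X]) * X ^ m := by
    obtain ⟨m, rfl⟩ := Nat.exists_eq_succ_of_ne_zero hm.ne'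
    simp; ring
  rw [derivative_add, derivative_add, derivative_one, add_zero, mul_add, h n hn, derivative_sum,
    Finset.mul_sum]
  congr 1
  exact Finset.sum_congr rfl fun i hi => h i (hS i hi)

theorem separable_X_pow_add_sum_add_one [CharP R 2] (hn : Odd n) (hS : ∀ i ∈ S, Odd i) :
    (X ^ n + ∑ i ∈ S, X ^ i + 1 : R[X]).Separable := by
  have h (m : ℕ) (hm : Odd m) : (m : R[X]) = 1 := by
    obtain ⟨l, rfl⟩ := hm
    push_cast
    rw [CharTwo.two_eq_zero, zero_mul, zero_add]
  refine ⟨1, -X, ?_⟩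
  rw [neg_mul, X_mul_derivative_X_pow_add_sum_add_one R hn.pos fun i hi => (hS i hi).pos, h n hn,
    Finset.sum_congr rfl fun i hi => congrArg (· * X ^ i) (h i (hS i hi))]
  simp only [one_mul]
  ring

end Sparse

/-! ### The discriminant modulo 8 -/

/-- The values of the derivative at the roots, up to a multiple of `8`. -/
theorem exists_prod_eval_derivative_eq {R : Type*} [CommRing R] [IsDomain R] [CharZero R]
    {n : ℕ} {S : Finset ℕ} (hn : Odd n)
    (hS : ∀ i ∈ S, (Odd i ∧ 3 * i < n) ∨ (i % 4 = n % 4 ∧ i < n)) {r : Fin n → R}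
    (hr : X ^ n + ∑ i ∈ S, X ^ i + 1 = ∏ i, (X - C (r i))) :
    ∃ B : R, ∏ i, (derivative (∏ j, (X - C (r j)))).eval (r i) = (n : R) ^ n + 8 * B := by
  have hn0 : 0 < n := hn.pos
  have hnm : n % 2 = 1 := Nat.odd_iff.mp hn
  have hodd : ∀ i ∈ S, i % 2 = 1 := fun i hi => by
    rcases hS i hi with ⟨h, -⟩ | ⟨h, -⟩
    · exact Nat.odd_iff.mp h
    · omega
  have hlt : ∀ i ∈ S, i < n := fun i hi => by
    rcases hS i hi with ⟨-, h⟩ | ⟨-, h⟩ <;> omega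
  have hcoeff (m : ℕ) (h0 : 0 < m) (hm : m < n) (hmS : m ∉ S) :
      (∏ i, (X - C (r i))).coeff m = 0 := hr ▸ coeff_X_pow_add_sum_add_one R n S h0 hm hmS
  have hpodd (k : ℕ) (hk : k % 2 = 1 ∧ k < n) : ∑ i, r i ^ k = 0 := by
    refine sum_pow_eq_zero_of_coeff r (fun k => k % 2 = 1 ∧ k < n) (fun k hk => by omega)
      (fun k hk => hcoeff _ (by omega) (by omega) fun h => ?_) (fun k j hk hj hjk => ?_) hk
    · have := hodd _ h; omega
    · by_cases h : n - j ∈ S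
      · have := hodd _ h; right; omega
      · exact .inl (hcoeff _ (by omega) (by omega) h)
  -- Below `2n/3`, an index `j` with `n - j ∈ S` must be divisible by 4, because `n - j` exceeds
  -- `n/3`; subtracting it preserves `k % 4 = 2`.
  have hptwo (k : ℕ) (hk : k % 4 = 2 ∧ 3 * k < 2 * n) : ∑ i, r i ^ k = 0 := by
    refine sum_pow_eq_zero_of_coeff r (fun k => k % 4 = 2 ∧ 3 * k < 2 * n) (fun k hk => by omega)
      (fun k hk => hcoeff _ (by omega) (by omega) fun h => ?_) (fun k j hk hj hjk => ?_) hk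
    · rcases hS _ h with ⟨-, h⟩ | ⟨h, -⟩ <;> omega
    · by_cases h : n - j ∈ S
      · right
        rcases hS _ h with ⟨-, h⟩ | ⟨h, -⟩ <;> omega
      · exact .inl (hcoeff _ (by omega) (by omega) h)
  let c : ℕ → ℤ := fun j => ((j : ℤ) - n) / 2
  have hc (j : ℕ) (hj : j ∈ S) : 2 * (c j : R) = j - n := by
    have h : 2 * c j = (j : ℤ) - n := by have := hodd j hj; simp only [c]; omega
    exact_mod_cast congrArg (Int.cast : ℤ → R) h
  let v : Fin n → R := fun i => ∑ j ∈ S, (c j : R) * r i ^ j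
  have hv (i : Fin n) :
      r i * (derivative (∏ j, (X - C (r j)))).eval (r i) = -(n : R) + 2 * v i := by
    have h0 : (∏ j, (X - C (r j))).eval (r i) = 0 := by
      rw [eval_prod, Finset.prod_eq_zero (Finset.mem_univ i) (by simp)]
    have h1 := congrArg (eval (r i)) (X_mul_derivative_X_pow_add_sum_add_one R hn0
      fun j hj => by have := hodd j hj; omega)
    rw [← hr] at h0 ⊢
    simp only [eval_mul, eval_add, eval_finsetSum, eval_pow, eval_X, eval_natCast, eval_one]
      at h0 h1
    have h2 : 2 * v i = ∑ j ∈ S, (j : R) * r i ^ j - n * ∑ j ∈ S, r i ^ j := by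
      rw [Finset.mul_sum, Finset.mul_sum, ← Finset.sum_sub_distrib]
      exact Finset.sum_congr rfl fun j hj => by linear_combination (r i ^ j) * hc j hj
    linear_combination h1 - h2 + n * h0
  have hsum : ∑ i, v i = 0 := by
    rw [Finset.sum_comm]
    refine Finset.sum_eq_zero fun j hj => ?_
    rw [← Finset.mul_sum, hpodd j ⟨hodd j hj, hlt j hj⟩, mul_zero]
  -- For `j ≡ n` modulo 4 the coefficient `c j` is even, giving `2 u`. The other exponents are odd,
  -- below `n/3` and congruent to each other modulo 4, so `t ^ 2` only involves exponents covered by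
  -- `hptwo`.
  obtain ⟨W, hW⟩ : ∃ W : R, ∑ i, v i ^ 2 = 4 * W := by
    let t : Fin n → R := fun i => ∑ j ∈ S with ¬ j % 4 = n % 4, (c j : R) * r i ^ j
    let u : Fin n → R := fun i => ∑ j ∈ S with j % 4 = n % 4, ((c j / 2 : ℤ) : R) * r i ^ j
    have hvtu (i : Fin n) : v i = t i + 2 * u i := by
      change ∑ j ∈ S, _ = _
      rw [add_comm, ← Finset.sum_filter_add_sum_filter_not S (fun j => j % 4 = n % 4)]
      congr 1
      rw [Finset.mul_sum]
      refine Finset.sum_congr rfl fun j hj => ?_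
      rw [Finset.mem_filter] at hj
      have h : c j = 2 * (c j / 2) := by simp only [c]; omega
      have h' : (c j : R) = 2 * ((c j / 2 : ℤ) : R) := by exact_mod_cast congrArg (Int.cast) h
      rw [h', mul_assoc]
    have ht : ∑ i, t i ^ 2 = 0 := by
      simp_rw [t, sq, Finset.sum_mul_sum]
      rw [Finset.sum_comm]
      refine Finset.sum_eq_zero fun j hj => ?_
      rw [Finset.sum_comm]
      refine Finset.sum_eq_zero fun l hl => ?_
      rw [Finset.mem_filter] at hj hl
      have h : (j + l) % 4 = 2 ∧ 3 * (j + l) < 2 * n := by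
        have := hodd j hj.1
        have := hodd l hl.1
        rcases hS j hj.1 with ⟨-, h1⟩ | ⟨h1, -⟩ <;> rcases hS l hl.1 with ⟨-, h2⟩ | ⟨h2, -⟩ <;> omega
      calc _ = ∑ i, (c j * c l : R) * r i ^ (j + l) :=
            Finset.sum_congr rfl fun i _ => by rw [pow_add]; ring
        _ = 0 := by rw [← Finset.mul_sum, hptwo _ h, mul_zero]
    refine ⟨∑ i, (t i * u i + u i ^ 2), ?_⟩
    rw [Finset.mul_sum, ← sub_zero (∑ i, v i ^ 2), ← ht, ← Finset.sum_sub_distrib]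
    exact Finset.sum_congr rfl fun i _ => by rw [hvtu]; ring
  obtain ⟨m, hm⟩ : ∃ m : ℤ, (-(n : ℤ)) ^ 2 = 1 + 8 * m := by
    obtain ⟨l, hl⟩ := hn
    obtain ⟨m, hm⟩ := Int.even_mul_succ_self (l : ℤ)
    exact ⟨m, by rw [hl]; push_cast; linear_combination 4 * hm⟩
  obtain ⟨E, B, h1, h2⟩ := exists_prod_add_two_mul Finset.univ v (a := -(n : R)) (m := m)
    (by simpa using congrArg (Int.cast : ℤ → R) hm)
  have hE : E = -2 * W := by
    refine mul_left_cancel₀ (two_ne_zero (α := R)) ?_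
    rw [hsum, hW] at h1
    linear_combination -h1
  -- Compare constant terms; `n` is odd.
  have hprod : ∏ i, r i = -1 := by
    have h := congrArg (eval 0) hr
    rw [eval_prod] at h
    simp only [eval_sub, eval_X, eval_C, zero_sub, Finset.prod_neg, Finset.card_univ,
      Fintype.card_fin, hn.neg_one_pow] at h
    have h0 : ∑ i ∈ S, (0 : R) ^ i = 0 :=
      Finset.sum_eq_zero fun i hi => zero_pow (by have := hodd i hi; omega)
    simp only [eval_add, eval_pow, eval_X, eval_finsetSum, eval_one, h0, zero_pow hn0.ne'] at h
    linear_combination h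
  simp_rw [← hv] at h2
  rw [Finset.prod_mul_distrib, hprod, hsum, hE, Finset.card_univ, Fintype.card_fin,
    hn.neg_pow] at h2
  exact ⟨-(n : R) ^ n * W - B, by linear_combination -h2⟩

open NumberField in
-- The product over the roots is evaluated in `𝓞 K` for a field `K` splitting the polynomial, and
-- the congruence descends to `ℤ`.
theorem eight_dvd_discr_sub {n : ℕ} {S : Finset ℕ} (hn : Odd n)
    (hS : ∀ i ∈ S, (Odd i ∧ 3 * i < n) ∨ (i % 4 = n % 4 ∧ i < n)) :
    (8 : ℤ) ∣ (X ^ n + ∑ i ∈ S, X ^ i + 1 : ℤ[X]).discr -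
      (-1) ^ (n * (n - 1) / 2) * (n : ℤ) ^ n := by
  have hn0 : 0 < n := hn.pos
  have hlt : ∀ i ∈ S, i < n := fun i hi => by
    rcases hS i hi with ⟨-, h⟩ | ⟨-, h⟩ <;> omega
  have hF := monic_X_pow_add_sum_add_one ℤ hn0 hlt
  have hdeg := natDegree_X_pow_add_sum_add_one ℤ hn0 hlt
  obtain ⟨K, _, _, -, hspl⟩ := exists_numberField_splits (X ^ n + ∑ i ∈ S, X ^ i + 1)
  obtain ⟨r, hr⟩ := RingOfIntegers.exists_map_eq_prod_X_sub_C hF hdeg hspl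
  obtain ⟨B, hB⟩ := exists_prod_eval_derivative_eq hn hS (r := r) (by
    simp [← hr, Polynomial.map_sum])
  apply RingOfIntegers.dvd_of_intCast_dvd_intCast (K := K)
  have h := hF.map_discr (algebraMap ℤ (𝓞 K)) (by rwa [hdeg])
  rw [hr, discr_prod_X_sub_C_eq_prod_eval_derivative r hn0, hB, algebraMap_int_eq,
    eq_intCast] at h
  refine ⟨(-1) ^ (n * (n - 1) / 2) * B, ?_⟩
  rw [Int.cast_sub, h]
  push_cast
  ring

/-! ### Residues of `n` modulo 8 and the conclusion -/

theorem mainTheorem1 (n : ℕ) (hn : Odd n) (S : Finset ℕ)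
    (hS : ∀ i ∈ S, (Odd i ∧ 0 < i ∧ (i : ℝ) < (n : ℝ) / 3) ∨ (i ≡ n [MOD 4] ∧ 0 < i ∧ i < n))
    (f : (ZMod 2)[X]) (hf : f = X ^ n + ∑ i ∈ S, X ^ i + 1)
    (F : ℤ[X]) (hF : F = X ^ n + ∑ i ∈ S, X ^ i + 1) :
    Squarefree f ∧
    (f.aroots (AlgebraicClosure (ZMod 2))).Nodup ∧
    (((n : ℤ) ≡ 1 [ZMOD 8] ∨ (n : ℤ) ≡ -1 [ZMOD 8]) →
      Odd (UniqueFactorizationMonoid.normalizedFactors f).card ∧ F.discr ≡ 1 [ZMOD 8]) ∧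
    (((n : ℤ) ≡ 3 [ZMOD 8] ∨ (n : ℤ) ≡ -3 [ZMOD 8]) →
      Even (UniqueFactorizationMonoid.normalizedFactors f).card ∧ F.discr ≡ 5 [ZMOD 8]) := by
  have hS' : ∀ i ∈ S, (Odd i ∧ 3 * i < n) ∨ (i % 4 = n % 4 ∧ i < n) := fun i hi => by
    rcases hS i hi with ⟨h1, -, h2⟩ | ⟨h1, -, h2⟩
    · have h3 : (3 * i : ℝ) < n := by linarith
      exact .inl ⟨h1, by exact_mod_cast h3⟩
    · exact .inr ⟨h1, h2⟩
  have hnm : n % 2 = 1 := Nat.odd_iff.mp hn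
  have hodd : ∀ i ∈ S, Odd i := fun i hi => by
    rcases hS' i hi with ⟨h, -⟩ | ⟨h, -⟩
    · exact h
    · exact Nat.odd_iff.mpr (by omega)
  have hlt : ∀ i ∈ S, i < n := fun i hi => by
    rcases hS' i hi with ⟨-, h⟩ | ⟨-, h⟩ <;> omega
  have hsep : f.Separable := hf ▸ separable_X_pow_add_sum_add_one (ZMod 2) hn hodd
  have hmap : F.map (algebraMap ℤ (ZMod 2)) = f := by
    rw [hF, hf]; simp [Polynomial.map_sum]
  have hmonic : F.Monic := hF ▸ monic_X_pow_add_sum_add_one ℤ hn.pos hlt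
  have hdeg : F.natDegree = n := hF ▸ natDegree_X_pow_add_sum_add_one ℤ hn.pos hlt
  have hdvd : (8 : ℤ) ∣ F.discr - (-1) ^ (n * (n - 1) / 2) * (n : ℤ) ^ n :=
    hF ▸ eight_dvd_discr_sub hn hS'
  have hpar (d : ℤ) (hd : F.discr = 4 * d + 1) :
      Even (n + (UniqueFactorizationMonoid.normalizedFactors f).card) ↔ Even d := by
    rw [← hdeg, ← hmap]
    exact even_natDegree_add_card_normalizedFactors_iff hmonic (by rw [hdeg]; exact hn.pos)
      (by rwa [hmap]) hd
  have hpow : (n : ℤ) ^ n ≡ n [ZMOD 8] := by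
    obtain ⟨l, hl⟩ := hn
    obtain ⟨m, hm⟩ := Int.even_mul_succ_self (l : ℤ)
    have hsq : (n : ℤ) ^ 2 ≡ 1 [ZMOD 8] :=
      (Int.modEq_iff_dvd.mpr ⟨m, by rw [hl]; push_cast; linear_combination 4 * hm⟩).symm
    calc (n : ℤ) ^ n = ((n : ℤ) ^ 2) ^ l * n := by rw [← pow_mul, ← pow_succ, ← hl]
      _ ≡ 1 ^ l * n [ZMOD 8] := (hsq.pow l).mul_right _
      _ = n := by rw [one_pow, one_mul]
  have hdisc (e : ℤ) (he : (-1 : ℤ) ^ (n * (n - 1) / 2) = e) : F.discr ≡ e * n [ZMOD 8] :=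
    (Int.modEq_iff_dvd.mpr (he ▸ hdvd)).symm.trans (hpow.mul_left e)
  have hsign (a b : ℕ) (h : n * (n - 1) = 2 * (2 * a + b)) :
      (-1 : ℤ) ^ (n * (n - 1) / 2) = (-1) ^ b := by
    rw [h, Nat.mul_div_cancel_left _ two_pos, pow_add, pow_mul]; simp
  obtain ⟨q, hq⟩ : ∃ q, n = 8 * q + 1 ∨ n = 8 * q + 3 ∨ n = 8 * q + 5 ∨ n = 8 * q + 7 :=
    ⟨n / 8, by omega⟩
  have hcases : ((n % 8 = 1 ∨ n % 8 = 7) ∧ F.discr ≡ 1 [ZMOD 8]) ∨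
      ((n % 8 = 3 ∨ n % 8 = 5) ∧ F.discr ≡ 5 [ZMOD 8]) := by
    rcases hq with rfl | rfl | rfl | rfl
    · have := hdisc 1 ((hsign ((8 * q + 1) * 2 * q) 0 (by rw [Nat.add_sub_cancel]; ring)))
      exact .inl ⟨by omega, by unfold Int.ModEq at *; push_cast at this; omega⟩
    · have := hdisc (-1) ((hsign ((8 * q + 3) * 2 * q + 4 * q + 1) 1 (by
        rw [show 8 * q + 3 - 1 = 8 * q + 2 by omega]; ring)))
      exact .inr ⟨by omega, by unfold Int.ModEq at *; push_cast at this; omega⟩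
    · have := hdisc 1 ((hsign ((8 * q + 5) * (2 * q + 1)) 0 (by
        rw [show 8 * q + 5 - 1 = 8 * q + 4 by omega]; ring)))
      exact .inr ⟨by omega, by unfold Int.ModEq at *; push_cast at this; omega⟩
    · have := hdisc (-1) ((hsign ((8 * q + 7) * (2 * q + 1) + 4 * q + 3) 1 (by
        rw [show 8 * q + 7 - 1 = 8 * q + 6 by omega]; ring)))
      exact .inl ⟨by omega, by unfold Int.ModEq at *; push_cast at this; omega⟩
  refine ⟨hsep.squarefree, nodup_roots hsep.map, fun h => ?_, fun h => ?_⟩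
  all_goals
    simp only [Int.ModEq] at h hcases ⊢
    -- In Stickelberger's theorem `d` is even for residue 1 and odd for residue 5; `n` being odd
    -- flips the parity of the count.
    have hD : F.discr = 4 * (F.discr / 4) + 1 := by omega
    have := hpar _ hD
    simp only [Nat.even_iff, Nat.odd_iff, Int.even_iff] at this ⊢
    omega
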